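/- Let $\mathcal H$ be a real Hilbert space and let $\mathcal T:\mathcal H\to 2^{\mathcal H}$ be a maximal monotone operator with $\mathcal T^{-1}(0)=\{w : 0\in\mathcal T w\}\neq\emptyset$. Let $\mathcal M:\mathcal H\to\mathcal H$ be an admissible preconditioner for $\mathcal T$, i.e. a bounded linear, self-adjoint, positive semidefinite operator such that $\widehat{\mathcal T}:=(\mathcal M+\mathcal T)^{-1}\mathcal M$ is single-valued and has full domain, and suppose that $\mathcal M$ has closed range. Write $\|w\|_{\mathcal M}=\sqrt{\langle w,\mathcal M w\rangle}$. Let $\alpha\ge 2$, $\rho\in(0,2]$, $\hat w^0=w^0\in\mathcal H$, and let the sequences $\{w^k\},\{\bar w^k\},\{\hat w^k\}$ be generated by the accelerated degenerate proximal point method (accelerated dPPM): for $k=0,1,2,\dots$, $$\bar w^k=\widehat{\mathcal T}w^k,\qquad \hat w^{k+1}=(1-\rho)w^k+\rho\,\bar w^k,$$ $$w^{k+1}=w^k+\frac{\alpha}{2(k+\alpha)}\left(\hat w^{k+1}-w^k\right)+\frac{k}{k+\alpha}\left(\hat w^{k+1}-\hat w^k\right).$$ Then: (a) if $\alpha=2$,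 then $$\|w^k-\hat w^{k+1}\|_{\mathcal M}\le\frac{2\|w^0-w^*\|_{\mathcal M}}{k+1}\qquad\text{for all } k\ge 0 \text{ and all } w^*\in\mathcal T^{-1}(0);$$ (b) if $\alpha>2$, then, as $k\to+\infty$, $$\|w^{k+1}-w^k\|_{\mathcal M}=o\left(\frac1{k+1}\right)\quad\text{and}\quad\|w^k-\hat w^{k+1}\|_{\mathcal M}=o\left(\frac1{k+1}\right).$$ -/

import Mathlib

open Filter Topology Asymptotics
open scoped InnerProductSpace

namespace DegeneratePPM

variable {H : Type*} [NormedAddCommGroup H] [InnerProductSpace ℝ H]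

/-- A set-valued operator `T : H → 2^H` is monotone if `⟪v - v', w - w'⟫ ≥ 0` for all
`v ∈ T w` and `v' ∈ T w'`. -/
def MonotoneOp (T : H → Set H) : Prop :=
  ∀ w w' v v' : H, v ∈ T w → v' ∈ T w' → 0 ≤ ⟪v - v', w - w'⟫_ℝ

/-- The graph of a set-valued operator. -/
def gph (T : H → Set H) : Set (H × H) :=
  {p | p.2 ∈ T p.1}

/-- A monotone operator is maximal if its graph is not properly contained in the graph of
another monotone operator. -/
def MaximalMonotoneOp (T : H → Set H) : Prop :=
  MonotoneOp T ∧ ∀ T' : H → Set H, MonotoneOp T' → ¬ gph T ⊂ gph T'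

/-- The set of zeros `T⁻¹(0)` of a set-valued operator. -/
def zeros (T : H → Set H) : Set H :=
  {w | (0 : H) ∈ T w}

/-- The set-valued operator `M + T`, for a single-valued linear `M`. -/
def addOp (M : H →L[ℝ] H) (T : H → Set H) : H → Set H :=
  fun w => {y | ∃ v ∈ T w, y = M w + v}

/-- The inverse of a set-valued operator: `w ∈ T⁻¹ v` if and only if `v ∈ T w`. -/
def invOp (T : H → Set H) : H → Set H :=
  fun v => {w | v ∈ T w}

/-- The set-valued operator `(M + T)⁻¹ M`. -/
def hatT (T : H → Set H) (M : H →L[ℝ] H) : H → Set H :=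
  fun w => invOp (addOp M T) (M w)

/-- `M` (linear and bounded) is an admissible preconditioner for `T`: it is self-adjoint and
positive semidefinite, and `(M + T)⁻¹ M` is single-valued with full domain. -/
def AdmissiblePreconditioner (T : H → Set H) (M : H →L[ℝ] H) : Prop :=
  M.IsPositive ∧ ∀ w : H, ∃! v : H, v ∈ hatT T M w

/-- The seminorm `‖w‖_M = √⟪w, M w⟫`. -/
noncomputable def normM (M : H →L[ℝ] H) (w : H) : ℝ :=
  √ ⟪w, M w⟫_ℝ

/-- The sequences `w`, `wbar`, `what` are generated by the accelerated degenerate proximal point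
method with parameters `α` and `ρ`, started at `w 0`. The entry `wbar k` is the value of the
(single-valued) operator `(M + T)⁻¹ M` at `w k`. -/
structure IsAccDPPM (T : H → Set H) (M : H →L[ℝ] H) (α ρ : ℝ) (w wbar what : ℕ → H) : Prop where
  init : what 0 = w 0
  step1 : ∀ k : ℕ, wbar k ∈ hatT T M (w k)
  step2 : ∀ k : ℕ, what (k + 1) = (1 - ρ) • w k + ρ • wbar k
  step3 : ∀ k : ℕ, w (k + 1) = w k + (α / (2 * ((k : ℝ) + α))) • (what (k + 1) - w k)
    + ((k : ℝ) / ((k : ℝ) + α)) • (what (k + 1) - what k)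

end DegeneratePPM

/-! In the degenerate inner product `⟪x, M y⟫`, the method is an inertial fixed point iteration
whose residual r_k = w^k - ŵ^{k+1} is cocoercive; with s_k = k(w^k - ŵ^k), seminorms suffice from
there on. Cocoercivity between consecutive iterates keeps `gap` nonnegative, hence k‖r_k‖ ≤ 2‖s_k‖.
For α = 2 the scheme is Halpern's, s_k = x_0 - x_k, and cocoercivity at the zero p improves k to k +
1. For α > 2 and each c in (1, α - 1), `energy` is nonnegative and eventually drops by at least
δ‖s_{k+1}‖²/(k+1). It is affine in c, so convergence for two values of c forces `kinetic` to
converge. Since `kinetic` lies between ‖s_k‖² and 2‖s_k‖², and ∑ ‖s_{k+1}‖²/(k+1) < ∞, its limit is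
0. Thus s_k → 0, which gives both rates. -/

namespace DegeneratePPM

/-! ### Real sequences: descent and comparison with the harmonic series. -/

section RealSequences

/-- A nonnegative sequence that eventually decreases by at least a nonnegative amount converges,
and the amounts are summable. -/
theorem exists_tendsto_and_summable_of_eventually_add_le {f g : ℕ → ℝ} (hf : ∀ k, 0 ≤ f k)
    (hg : ∀ k, 0 ≤ g k) (h : ∀ᶠ k in atTop, f (k + 1) + g k ≤ f k) :
    (∃ l, Tendsto f atTop (𝓝 l)) ∧ Summable g := by
  obtain ⟨N, hN⟩ := eventually_atTop.1 h
  have hN' : ∀ k, f (k + 1 + N) + g (k + N) ≤ f (k + N) := fun k => by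
    have := hN (k + N) (by omega)
    rwa [show k + N + 1 = k + 1 + N by omega] at this
  constructor
  · have hanti : Antitone fun k => f (k + N) := antitone_nat_of_succ_le fun k => by
      linarith [hN' k, hg (k + N)]
    exact ⟨_, (tendsto_add_atTop_iff_nat N).1
      (tendsto_atTop_ciInf hanti ⟨0, by rintro _ ⟨k, rfl⟩; exact hf _⟩)⟩
  · refine (summable_nat_add_iff N).1
      (summable_of_sum_range_le (c := f N) (fun k => hg _) fun n => ?_)
    suffices H : ∑ i ∈ Finset.range n, g (i + N) ≤ f N - f (n + N) by linarith [hf (n + N)]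
    induction n with
    | zero => simp
    | succ n ih => rw [Finset.sum_range_succ]; linarith [hN' n]

/-- A convergent sequence dominated by a multiple of `a` has a nonpositive limit if
`∑ a (k + 1) / (k + 1)` converges. -/
theorem le_zero_of_tendsto_of_summable_div {R a : ℕ → ℝ} {l : ℝ} (hR : Tendsto R atTop (𝓝 l))
    (hRa : ∀ k, R k ≤ 2 * a k)
    (ha : Summable fun k : ℕ => a (k + 1) / ((k : ℝ) + 1)) : l ≤ 0 := by
  by_contra! hl
  have hev : ∀ᶠ k in atTop, l / 2 < R (k + 1) :=
    ((tendsto_add_atTop_iff_nat 1).2 hR).eventually (lt_mem_nhds (by linarith))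
  obtain ⟨N, hN⟩ := eventually_atTop.1 hev
  -- If l > 0, then eventually a ≥ l/4, so the series would dominate a harmonic tail.
  have hsum : Summable fun k : ℕ => 1 / (((k + (N + 1) : ℕ)) : ℝ) := by
    refine Summable.of_nonneg_of_le (fun k => by positivity) (fun k => ?_)
      (((summable_nat_add_iff N).2 ha).mul_left (4 / l))
    have h1 : l / 4 ≤ a (k + N + 1) := by linarith [hN (k + N) (by omega), hRa (k + N + 1)]
    have hpos : (0 : ℝ) < (k : ℝ) + N + 1 := by positivity
    push_cast
    rw [← add_assoc, ← mul_div_assoc]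
    refine div_le_div_of_nonneg_right ?_ hpos.le
    calc (1 : ℝ) = 4 / l * (l / 4) := by field_simp
      _ ≤ 4 / l * a (k + N + 1) := by gcongr
  exact Real.not_summable_one_div_natCast ((summable_nat_add_iff (N + 1)).1 hsum)

end RealSequences

/-! ### Accelerated iteration in a seminormed space: the gap and the case α = 2. -/

section Abstract

variable {E : Type*} [SeminormedAddCommGroup E] [InnerProductSpace ℝ E]

/-- Iterates `x`, residuals `r` and scaled momenta `s` of the accelerated fixed point iteration
for the residual map `r = id - N` of a nonexpansive map `N` with fixed point `p`. Nonexpansiveness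
of `N` is used only along the iterates, as cocoercivity of the residuals. -/
structure IsAccIteration (α : ℝ) (x r s : ℕ → E) (p : E) : Prop where
  momentum_zero : s 0 = 0
  step : ∀ k : ℕ, ((k : ℝ) + α) • (x (k + 1) - x k) = s k - ((k : ℝ) + α / 2) • r k
  momentum_succ : ∀ k : ℕ, s (k + 1) = ((k : ℝ) + 1) • (x (k + 1) - x k + r k)
  cocoercive : ∀ k : ℕ, ‖r (k + 1) - r k‖ ^ 2 ≤ 2 * ⟪r (k + 1) - r k, x (k + 1) - x k⟫_ℝ
  cocoercive_fixed : ∀ k : ℕ, ‖r k‖ ^ 2 ≤ 2 * ⟪r k, x k - p⟫_ℝ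

namespace IsAccIteration

variable {α : ℝ} {x r s : ℕ → E} {p : E}

/-- The gap `2⟪r, s⟫ - k‖r‖²`. -/
noncomputable def gap (r s : ℕ → E) (k : ℕ) : ℝ := 2 * ⟪r k, s k⟫_ℝ - k * ‖r k‖ ^ 2

/-- The part of the energy that is linear in the parameter. -/
noncomputable def anchor (α : ℝ) (x s : ℕ → E) (p : E) (k : ℕ) : ℝ :=
  2 * ⟪x k - p, s k⟫_ℝ + (α - 1) * ‖x k - p‖ ^ 2

/-- The part of the energy that does not depend on the parameter. -/
noncomputable def kinetic (r s : ℕ → E) (k : ℕ) : ℝ := 2 * ‖s k‖ ^ 2 - k * gap r s k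

/-- The Lyapunov energy with parameter `c`. -/
noncomputable def energy (α c : ℝ) (x r s : ℕ → E) (p : E) (k : ℕ) : ℝ :=
  2 * c * anchor α x s p k + kinetic r s k

theorem momentum_eq (h : IsAccIteration α x r s p) (k : ℕ) :
    s k = ((k : ℝ) + α) • (x (k + 1) - x k) + ((k : ℝ) + α / 2) • r k := by
  rw [h.step]; abel

theorem gap_eq (h : IsAccIteration α x r s p) (k : ℕ) :
    gap r s k = (k + α) * (2 * ⟪x (k + 1) - x k, r k⟫_ℝ + ‖r k‖ ^ 2) := by
  rw [gap, h.momentum_eq k, inner_add_right, inner_smul_right, inner_smul_right,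
    real_inner_self_eq_norm_sq, real_inner_comm]
  ring

/-- This is `cocoercive` multiplied by (k + α)(k + 1), with the momenta eliminated. -/
theorem gap_step (h : IsAccIteration α x r s p) (hα : 0 ≤ α) (k : ℕ) :
    (k + 1) * gap r s k ≤ (k + α) * gap r s (k + 1) := by
  have hco := h.cocoercive k
  rw [h.gap_eq k, gap, h.momentum_succ k]
  generalize x (k + 1) - x k = d at *
  rw [norm_sub_sq_real, inner_sub_left, real_inner_comm d (r k)] at hco
  rw [inner_smul_right, inner_add_right]
  push_cast
  have hk : (0 : ℝ) ≤ (k + α) * (k + 1) := by positivity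
  nlinarith [mul_le_mul_of_nonneg_left hco hk]

theorem gap_nonneg (h : IsAccIteration α x r s p) (hα : 0 < α) (k : ℕ) : 0 ≤ gap r s k := by
  induction k with
  | zero => simp [gap, h.momentum_zero]
  | succ k ih =>
    have h1 := h.gap_step hα.le k
    have h2 : (0 : ℝ) ≤ (k + 1) * gap r s k := by positivity
    exact nonneg_of_mul_nonneg_right (h2.trans h1) (by positivity)

theorem mul_norm_residual_le (h : IsAccIteration α x r s p) (hα : 0 < α) (k : ℕ) :
    k * ‖r k‖ ≤ 2 * ‖s k‖ := by
  rcases (norm_nonneg (r k)).eq_or_lt with h0 | hpos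
  · rw [← h0]; simp
  · have h1 := h.gap_nonneg hα k
    rw [gap] at h1
    have h2 := real_inner_le_norm (r k) (s k)
    refine le_of_mul_le_mul_right ?_ hpos
    nlinarith

theorem momentum_eq_initial_sub (h : IsAccIteration 2 x r s p) (k : ℕ) : s k = x 0 - x k := by
  induction k with
  | zero => simp [h.momentum_zero]
  | succ k ih =>
    have h1 : s (k + 1) = s k - (x (k + 1) - x k) := by
      rw [h.momentum_succ k, h.momentum_eq k]; module
    rw [h1, ih]; abel

/-- Splitting x_0 - x_k at p in the gap inequality leaves -2⟪r_k, x_k - p⟫ ≤ -‖r_k‖², the source of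
the extra 1; Cauchy–Schwarz finishes. -/
theorem norm_residual_le (h : IsAccIteration 2 x r s p) (k : ℕ) :
    ‖r k‖ ≤ 2 * ‖x 0 - p‖ / (k + 1) := by
  rw [le_div_iff₀ (by positivity)]
  rcases (norm_nonneg (r k)).eq_or_lt with h0 | hpos
  · rw [← h0, zero_mul]; positivity
  · have h1 := h.gap_nonneg two_pos k
    have h2 := real_inner_le_norm (r k) (x 0 - p)
    have h3 := h.cocoercive_fixed k
    rw [gap, h.momentum_eq_initial_sub k,
      show x 0 - x k = (x 0 - p) - (x k - p) by abel, inner_sub_right] at h1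
    refine le_of_mul_le_mul_right ?_ hpos
    nlinarith

/-! ### Lyapunov analysis for α > 2. -/

theorem sq_norm_momentum_le_kinetic (r s : ℕ → E) (k : ℕ) : ‖s k‖ ^ 2 ≤ kinetic r s k := by
  -- `kinetic` equals ‖s_k‖² + ‖s_k - k r_k‖².
  have h1 : 0 ≤ ‖s k - (k : ℝ) • r k‖ ^ 2 := by positivity
  rw [norm_sub_sq_real, norm_smul, Real.norm_natCast, inner_smul_right,
    real_inner_comm (r k) (s k)] at h1
  rw [kinetic, gap]
  nlinarith

theorem kinetic_le (h : IsAccIteration α x r s p) (hα : 0 < α) (k : ℕ) :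
    kinetic r s k ≤ 2 * ‖s k‖ ^ 2 := by
  have := h.gap_nonneg hα k
  rw [kinetic]
  have h2 : 0 ≤ (k : ℝ) * gap r s k := by positivity
  linarith

theorem inner_residual_nonneg (h : IsAccIteration α x r s p) (k : ℕ) :
    0 ≤ ⟪r k, x k - p⟫_ℝ := by
  nlinarith [h.cocoercive_fixed k, sq_nonneg ‖r k‖]

theorem energy_nonneg (h : IsAccIteration α x r s p) {c : ℝ} (hc : 0 ≤ c) (hcα : c ≤ α - 1)
    (k : ℕ) : 0 ≤ energy α c x r s p k := by
  -- The energy is half this square, plus twice `h2`, twice `h3` and half `h4`.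
  have h1 : 0 ≤ ‖(2 * c) • (x k - p) + ((2 : ℝ) • s k - (k : ℝ) • r k)‖ ^ 2 := by positivity
  have h2 : 0 ≤ c * (α - 1 - c) * ‖x k - p‖ ^ 2 :=
    mul_nonneg (mul_nonneg hc (by linarith)) (by positivity)
  have h3 : 0 ≤ c * (k * ⟪r k, x k - p⟫_ℝ) :=
    mul_nonneg hc (mul_nonneg (by positivity) (h.inner_residual_nonneg k))
  have h4 : 0 ≤ (k : ℝ) ^ 2 * ‖r k‖ ^ 2 := by positivity
  rw [energy, anchor, kinetic, gap]
  rw [← real_inner_self_eq_norm_sq] at h1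
  generalize x k - p = X at *
  simp only [inner_add_left, inner_add_right, inner_sub_left, inner_sub_right, inner_smul_left,
    inner_smul_right, real_inner_self_eq_norm_sq, conj_trivial, real_inner_comm X (s k),
    real_inner_comm X (r k), real_inner_comm (r k) (s k)] at h1 h3 ⊢
  linarith

theorem energy_succ_le (h : IsAccIteration α x r s p) (hα : 2 ≤ α) {c : ℝ} (hc : 0 ≤ c) (k : ℕ) :
    energy α c x r s p (k + 1) ≤ energy α c x r s p k
      - 2 * (α - 1 - c) * (2 * k + α + 1) * ‖x (k + 1) - x k‖ ^ 2
      + (4 * (c + 1 - α) * k + 4 * c + 4 - 2 * α ^ 2) * ⟪x (k + 1) - x k, r k⟫_ℝ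
      - ((α - 2) * k + (α ^ 2 / 2 - 2)) * ‖r k‖ ^ 2 := by
  have hn : (0 : ℝ) < k + α := by positivity
  have hk1 : ((k : ℝ) + 1) * ((k + 1) * gap r s k) ≤ (k + 1) * ((k + α) * gap r s (k + 1)) :=
    mul_le_mul_of_nonneg_left (h.gap_step (by linarith) k) (by positivity)
  have hgap : k * gap r s k - (k + 1) * gap r s (k + 1)
      ≤ (α - 2) * k * (2 * ⟪x (k + 1) - x k, r k⟫_ℝ + ‖r k‖ ^ 2) := by
    refine le_of_mul_le_mul_left ?_ hn
    have h0 := h.gap_nonneg (by linarith) k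
    have h1 := h.gap_eq k
    -- The coefficient is k(k + α) - (k + 1)² = (α - 2)k - 1; the -1 is dropped since the gap is
    -- nonnegative.
    calc (k + α) * (k * gap r s k - (k + 1) * gap r s (k + 1))
        ≤ (α - 2) * k * gap r s k := by nlinarith
      _ = _ := by rw [h1]; ring
  -- The ⟪x_k - p, d⟫ terms cancel, thanks to the weight α - 1 in `anchor`; only this signed term
  -- involving p remains.
  have hX : 0 ≤ c * ((α - 2) * ⟪r k, x k - p⟫_ℝ) :=
    mul_nonneg hc (mul_nonneg (by linarith) (h.inner_residual_nonneg k))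
  have hsucc : x (k + 1) - p = (x k - p) + (x (k + 1) - x k) := by abel
  have hs := h.momentum_eq k
  have hs' := h.momentum_succ k
  rw [energy, energy, anchor, anchor, kinetic, kinetic, hs', hs, hsucc]
  push_cast
  generalize x (k + 1) - x k = d at *
  generalize x k - p = X at *
  simp only [← real_inner_self_eq_norm_sq] at hgap ⊢
  simp only [inner_add_left, inner_add_right, inner_smul_left,
    inner_smul_right, conj_trivial, real_inner_comm d X,
    real_inner_comm X (r k), real_inner_comm d (r k)] at hX hgap ⊢
  linarith

theorem exists_eventually_energy_add_le (h : IsAccIteration α x r s p) (hα : 2 < α) {c : ℝ}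
    (hc : 1 < c) (hcα : c < α - 1) :
    ∃ δ > 0, ∀ᶠ k : ℕ in atTop,
      energy α c x r s p (k + 1) + δ * (‖s (k + 1)‖ ^ 2 / ((k : ℝ) + 1))
        ≤ energy α c x r s p k := by
  obtain ⟨m, hm, hm1, hm2⟩ : ∃ m > 0, m ≤ α - 1 - c ∧ m ≤ c - 1 :=
    ⟨min (α - 1 - c) (c - 1), lt_min (by linarith) (by linarith), min_le_left _ _,
      min_le_right _ _⟩
  set b : ℝ := 4 * c + 4 - 2 * α ^ 2 with hb
  refine ⟨m / 16, by positivity, ?_⟩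
  filter_upwards [eventually_ge_atTop (⌈2 * |b| / m⌉₊ + 1)] with k hk
  have hk1 : (1 : ℝ) ≤ k := by exact_mod_cast (by omega : 1 ≤ k)
  have hkb : 2 * |b| ≤ m * k := by
    have : 2 * |b| / m ≤ k := (Nat.le_ceil _).trans (by exact_mod_cast (by omega))
    rw [div_le_iff₀ hm] at this; linarith
  have hE := h.energy_succ_le hα.le (by linarith : 0 ≤ c) k
  rw [h.momentum_succ k, norm_smul, Real.norm_of_nonneg (by positivity : (0 : ℝ) ≤ k + 1)]
  generalize x (k + 1) - x k = d at *
  have e1 : ((k + 1) * ‖d + r k‖) ^ 2 / ((k : ℝ) + 1) = (k + 1) * ‖d + r k‖ ^ 2 := by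
    field_simp
  have e2 := norm_add_sq_real d (r k)
  have e3 : 0 ≤ ‖d - r k‖ ^ 2 := by positivity
  have e4 : 0 ≤ ‖d + r k‖ ^ 2 := by positivity
  have e5 : 0 ≤ ‖(2 : ℝ) • d + r k‖ ^ 2 := by positivity
  have e6 : 0 ≤ ‖(7 / 2 : ℝ) • d + (2 : ℝ) • r k‖ ^ 2 := by positivity
  rw [norm_sub_sq_real] at e3
  rw [norm_add_sq_real] at e4
  rw [norm_add_sq_real, norm_smul, inner_smul_left] at e5
  rw [norm_add_sq_real, norm_smul, norm_smul, inner_smul_left, inner_smul_right] at e6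
  norm_num [mul_pow] at e5 e6
  have hD := sq_nonneg ‖d‖
  have hQ := sq_nonneg ‖r k‖
  rw [e1, e2]
  generalize ‖d‖ ^ 2 = D at *
  generalize ‖r k‖ ^ 2 = Q at *
  -- D, Q, P stand for ‖d‖², ‖r_k‖², ⟪d, r_k⟫.
  generalize ⟪d, r k⟫_ℝ = P at *
  -- The cross term not growing with k costs at most half of the order-k dissipation in `hmain`.
  have hbP : b * P ≤ m * k / 4 * (D + Q) := by
    have h1 : |P| ≤ (D + Q) / 2 := abs_le.2 ⟨by linarith, by linarith⟩
    calc b * P ≤ |b| * |P| := by rw [← abs_mul]; exact le_abs_self _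
      _ ≤ m * k / 2 * ((D + Q) / 2) :=
        mul_le_mul (by linarith) h1 (abs_nonneg _) (by positivity)
      _ = _ := by ring
  -- The right side is (α - 1 - c)‖2d + r‖² + (c - 1)‖r‖², positive definite because 1 < c < α - 1.
  have hmain : m * ((D + Q) / 2) ≤ 4 * (α - 1 - c) * D + 4 * (α - 1 - c) * P + (α - 2) * Q := by
    have h1 : 0 ≤ (α - 1 - c - m) * (4 * D + 4 * P + Q) :=
      mul_nonneg (by linarith) (by linarith)
    have h2 : 0 ≤ (c - 1 - m) * Q := mul_nonneg (by linarith) hQ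
    have h3 : 0 ≤ m * (7 / 2 * D + 4 * P + 3 / 2 * Q) := mul_nonneg hm.le (by linarith)
    linarith
  have hmain' := mul_le_mul_of_nonneg_left hmain (by linarith : (0 : ℝ) ≤ k)
  have hs : ((k : ℝ) + 1) * (D + 2 * P + Q) ≤ 2 * k * (2 * (D + Q)) :=
    mul_le_mul (by linarith) (by linarith) e4 (by linarith)
  have hs' := mul_le_mul_of_nonneg_left hs hm.le
  have hD' : 0 ≤ (α - 1 - c) * (α + 1) * D :=
    mul_nonneg (mul_nonneg (by linarith) (by linarith)) hD
  have hQ' : 0 ≤ (α ^ 2 / 2 - 2) * Q := mul_nonneg (by nlinarith) hQ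
  linarith

theorem tendsto_norm_momentum (h : IsAccIteration α x r s p) (hα : 2 < α) :
    Tendsto (fun k => ‖s k‖) atTop (𝓝 0) := by
  have key : ∀ c : ℝ, 1 < c → c < α - 1 →
      (∃ l, Tendsto (energy α c x r s p) atTop (𝓝 l)) ∧
        Summable fun k : ℕ => ‖s (k + 1)‖ ^ 2 / ((k : ℝ) + 1) := by
    intro c hc hcα
    obtain ⟨δ, hδ, hev⟩ := h.exists_eventually_energy_add_le hα hc hcα
    obtain ⟨hl, hs⟩ := exists_tendsto_and_summable_of_eventually_add_le
      (h.energy_nonneg (by linarith) hcα.le) (fun k => by positivity) hev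
    exact ⟨hl, (summable_mul_left_iff hδ.ne').1 hs⟩
  obtain ⟨⟨l₁, hl₁⟩, hs⟩ := key (1 + (α - 2) / 4) (by linarith) (by linarith)
  obtain ⟨⟨l₂, hl₂⟩, -⟩ := key (1 + (α - 2) / 2) (by linarith) (by linarith)
  set c₁ : ℝ := 1 + (α - 2) / 4 with hc₁
  set c₂ : ℝ := 1 + (α - 2) / 2 with hc₂
  have hc : c₂ - c₁ ≠ 0 := by rw [hc₁, hc₂]; intro h0; linarith
  -- This combination of the two energies eliminates `anchor`.
  have hkin : Tendsto (kinetic r s) atTop (𝓝 ((c₂ * l₁ - c₁ * l₂) / (c₂ - c₁))) := by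
    refine (((hl₁.const_mul c₂).sub (hl₂.const_mul c₁)).div_const (c₂ - c₁)).congr fun k => ?_
    rw [energy, energy, div_eq_iff hc]
    ring
  have hle := le_zero_of_tendsto_of_summable_div hkin (h.kinetic_le (by linarith)) hs
  have hge := ge_of_tendsto' hkin fun k => (sq_nonneg _).trans (sq_norm_momentum_le_kinetic r s k)
  rw [le_antisymm hle hge] at hkin
  have hsq : Tendsto (fun k => ‖s k‖ ^ 2) atTop (𝓝 0) :=
    squeeze_zero (fun k => by positivity) (sq_norm_momentum_le_kinetic r s) hkin
  simpa using hsq.sqrt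

theorem tendsto_mul_norm_residual (h : IsAccIteration α x r s p) (hα : 2 < α) :
    Tendsto (fun k : ℕ => ((k : ℝ) + 1) * ‖r k‖) atTop (𝓝 0) := by
  refine squeeze_zero' (Eventually.of_forall fun k => by positivity) ?_
    (by simpa using (h.tendsto_norm_momentum hα).const_mul 4)
  filter_upwards [eventually_ge_atTop 1] with k hk
  have hk1 : (1 : ℝ) ≤ k := by exact_mod_cast hk
  have := h.mul_norm_residual_le (by linarith) k
  nlinarith [norm_nonneg (r k)]

theorem tendsto_mul_norm_sub (h : IsAccIteration α x r s p) (hα : 2 < α) :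
    Tendsto (fun k : ℕ => ((k : ℝ) + 1) * ‖x (k + 1) - x k‖) atTop (𝓝 0) := by
  have hlim := ((tendsto_add_atTop_iff_nat 1).2 (h.tendsto_norm_momentum hα)).add
    (h.tendsto_mul_norm_residual hα)
  rw [add_zero] at hlim
  refine squeeze_zero (fun k => by positivity) (fun k => ?_) hlim
  have hk : (0 : ℝ) ≤ k + 1 := by positivity
  rw [h.momentum_succ k, norm_smul, Real.norm_of_nonneg hk, ← mul_add]
  refine mul_le_mul_of_nonneg_left ?_ hk
  simpa using norm_sub_le (x (k + 1) - x k + r k) (r k)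

end IsAccIteration

end Abstract

/-! ### Reduction of the method to the abstract iteration. -/

section Preconditioned

variable {H : Type*} [NormedAddCommGroup H] [InnerProductSpace ℝ H]

/-- The degenerate inner product `⟪x, M y⟫` of a positive operator. -/
@[reducible] noncomputable def preCore (M : H →L[ℝ] H) (hM : M.IsPositive) :
    PreInnerProductSpace.Core ℝ H where
  inner x y := ⟪x, M y⟫_ℝ
  conj_inner_symm x y := by
    have h := hM.1 x y
    simp only [ContinuousLinearMap.coe_coe] at h
    rw [conj_trivial, ← h, real_inner_comm]
  re_inner_nonneg x := by
    have h := hM.2 x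
    rw [ContinuousLinearMap.reApplyInnerSelf_apply] at h
    simpa [real_inner_comm] using h
  add_left x y z := inner_add_left _ _ _
  smul_left x y c := by simp [inner_smul_left]

/-- The seminorm `‖·‖_M` as a seminormed group structure. -/
@[reducible] noncomputable def preSeminormedGroup (M : H →L[ℝ] H) (hM : M.IsPositive) :
    SeminormedAddCommGroup H :=
  @InnerProductSpace.Core.toSeminormedAddCommGroup ℝ H _ _ _ (preCore M hM)

/-- The degenerate inner product space structure with norm `‖·‖_M`. -/
@[reducible] noncomputable def preInnerProductSpace (M : H →L[ℝ] H) (hM : M.IsPositive) :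
    @InnerProductSpace ℝ H _ (preSeminormedGroup M hM) :=
  InnerProductSpace.ofCore (preCore M hM)

theorem inner_map_comm {M : H →L[ℝ] H} (hM : M.IsPositive) (x y : H) :
    ⟪x, M y⟫_ℝ = ⟪y, M x⟫_ℝ := (preCore M hM).conj_inner_symm y x

theorem inner_map_self_nonneg {M : H →L[ℝ] H} (hM : M.IsPositive) (x : H) :
    0 ≤ ⟪x, M x⟫_ℝ := (preCore M hM).re_inner_nonneg x

/-- Cocoercivity of `ρ (id - (M + T)⁻¹ M)` with respect to `M`. -/
theorem cocoercive_hatT {T : H → Set H} (hT : MonotoneOp T) {M : H →L[ℝ] H} (hM : M.IsPositive)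
    {ρ : ℝ} (hρ0 : 0 < ρ) (hρ2 : ρ ≤ 2) {w w' u u' : H} (hu : u ∈ hatT T M w)
    (hu' : u' ∈ hatT T M w') :
    ⟪ρ • (w - u) - ρ • (w' - u'), M (ρ • (w - u) - ρ • (w' - u'))⟫_ℝ
      ≤ 2 * ⟪ρ • (w - u) - ρ • (w' - u'), M (w - w')⟫_ℝ := by
  obtain ⟨v, hv, hMv⟩ := hu
  obtain ⟨v', hv', hMv'⟩ := hu'
  have h1 := hT u u' v v' hv hv'
  set e := (w - u) - (w' - u') with he
  set d := u - u' with hd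
  have hvv : v - v' = M e := by
    rw [he, map_sub, map_sub, map_sub, hMv, hMv']; abel
  have hww : w - w' = e + d := by rw [he, hd]; abel
  rw [hvv, real_inner_comm, inner_map_comm hM] at h1
  have h2 := inner_map_self_nonneg hM e
  rw [← smul_sub, hww]
  simp only [map_add, map_smul, inner_add_right, inner_smul_left, inner_smul_right, conj_trivial]
  -- The slack in the claim is 2ρ⟪e, M d⟫ + ρ(2 - ρ)⟪e, M e⟫: monotonicity signs the first term, ρ ≤
  -- 2 the second.
  have h3 : 0 ≤ ρ * ⟪e, M d⟫_ℝ := mul_nonneg hρ0.le h1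
  have h4 : 0 ≤ ρ * (2 - ρ) * ⟪e, M e⟫_ℝ := mul_nonneg (mul_nonneg hρ0.le (by linarith)) h2
  linarith

theorem mem_hatT_of_mem_zeros {T : H → Set H} (M : H →L[ℝ] H) {p : H} (hp : p ∈ zeros T) :
    p ∈ hatT T M p := ⟨0, hp, by simp⟩

theorem IsAccDPPM.residual_eq {T : H → Set H} {M : H →L[ℝ] H} {α ρ : ℝ} {w wbar what : ℕ → H}
    (hw : IsAccDPPM T M α ρ w wbar what) (k : ℕ) :
    w k - what (k + 1) = ρ • (w k - wbar k) := by
  rw [hw.step2]; module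

/-- The accelerated degenerate proximal point method is an accelerated fixed point iteration for
the degenerate inner product induced by the preconditioner. -/
theorem IsAccDPPM.isAccIteration {T : H → Set H} (hT : MonotoneOp T) {M : H →L[ℝ] H}
    (hM : M.IsPositive) {α ρ : ℝ} (hα : 0 < α) (hρ0 : 0 < ρ) (hρ2 : ρ ≤ 2)
    {w wbar what : ℕ → H} (hw : IsAccDPPM T M α ρ w wbar what) {p : H} (hp : p ∈ zeros T) :
    @IsAccIteration H (preSeminormedGroup M hM) (preInnerProductSpace M hM) α w
      (fun k => w k - what (k + 1)) (fun k => (k : ℝ) • (w k - what k)) p := by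
  have hsq : ∀ u : H, √ ⟪u, M u⟫_ℝ ^ 2 = ⟪u, M u⟫_ℝ :=
    fun u => Real.sq_sqrt (inner_map_self_nonneg hM u)
  refine @IsAccIteration.mk H (preSeminormedGroup M hM) (preInnerProductSpace M hM) α w _ _ p ?_ ?_ ?_ ?_ ?_
  · change ((0 : ℕ) : ℝ) • (w 0 - what 0) = 0
    simp
  · intro k
    change ((k : ℝ) + α) • (w (k + 1) - w k)
      = (k : ℝ) • (w k - what k) - ((k : ℝ) + α / 2) • (w k - what (k + 1))
    have hn : (k : ℝ) + α ≠ 0 := by positivity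
    rw [hw.step3 k]
    match_scalars <;> field_simp <;> ring
  · intro k
    change ((k + 1 : ℕ) : ℝ) • (w (k + 1) - what (k + 1))
      = ((k : ℝ) + 1) • (w (k + 1) - w k + (w k - what (k + 1)))
    push_cast
    module
  · intro k
    have h := cocoercive_hatT hT hM hρ0 hρ2 (hw.step1 (k + 1)) (hw.step1 k)
    rw [← hw.residual_eq, ← hw.residual_eq] at h
    exact (hsq _).trans_le h
  · intro k
    have h := cocoercive_hatT hT hM hρ0 hρ2 (hw.step1 k) (mem_hatT_of_mem_zeros M hp)
    rw [← hw.residual_eq, sub_self, smul_zero, sub_zero] at h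
    exact (hsq _).trans_le h

end Preconditioned

theorem isLittleO_one_div_succ {f : ℕ → ℝ}
    (h : Tendsto (fun k : ℕ => ((k : ℝ) + 1) * f k) atTop (𝓝 0)) :
    f =o[atTop] fun k : ℕ => 1 / ((k : ℝ) + 1) := by
  rw [isLittleO_iff_tendsto fun k hk => absurd hk (by positivity)]
  simpa [mul_comm] using h

end DegeneratePPM

theorem mainTheorem3 {H : Type*} [NormedAddCommGroup H] [InnerProductSpace ℝ H] [CompleteSpace H]
    (T : H → Set H) (hT : DegeneratePPM.MaximalMonotoneOp T)
    (hzero : (DegeneratePPM.zeros T).Nonempty)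
    (M : H →L[ℝ] H) (hM : DegeneratePPM.AdmissiblePreconditioner T M)
    (hMclosed : IsClosed (Set.range M))
    (α ρ : ℝ) (hα : 2 ≤ α) (hρ0 : 0 < ρ) (hρ2 : ρ ≤ 2)
    (w wbar what : ℕ → H) (hw : DegeneratePPM.IsAccDPPM T M α ρ w wbar what) :
    (α = 2 → ∀ k : ℕ, ∀ wstar ∈ DegeneratePPM.zeros T,
      DegeneratePPM.normM M (w k - what (k + 1))
        ≤ 2 * DegeneratePPM.normM M (w 0 - wstar) / ((k : ℝ) + 1)) ∧
    (2 < α →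
      (fun k : ℕ => DegeneratePPM.normM M (w (k + 1) - w k))
        =o[atTop] (fun k : ℕ => 1 / ((k : ℝ) + 1)) ∧
      (fun k : ℕ => DegeneratePPM.normM M (w k - what (k + 1)))
        =o[atTop] (fun k : ℕ => 1 / ((k : ℝ) + 1))) := by
  -- `normM` is definitionally the norm of the induced structure, so the abstract bounds apply
  -- verbatim.
  have key := fun p hp => hw.isAccIteration hT.1 hM.1 (by linarith) hρ0 hρ2 (p := p) hp
  let i₁ := DegeneratePPM.preSeminormedGroup M hM.1
  let i₂ := DegeneratePPM.preInnerProductSpace M hM.1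
  refine ⟨fun h2 k p hp => ?_, fun h2 => ?_⟩
  · subst h2
    exact @DegeneratePPM.IsAccIteration.norm_residual_le H i₁ i₂ _ _ _ _ (key p hp) k
  · obtain ⟨p, hp⟩ := hzero
    exact ⟨DegeneratePPM.isLittleO_one_div_succ
        (@DegeneratePPM.IsAccIteration.tendsto_mul_norm_sub H i₁ i₂ _ _ _ _ _ (key p hp) h2),
      DegeneratePPM.isLittleO_one_div_succ
        (@DegeneratePPM.IsAccIteration.tendsto_mul_norm_residual H i₁ i₂ _ _ _ _ _
          (key p hp) h2)⟩
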